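/- Notation. For $n\ge 1$ let $T_n$ be the set of triangular $0$-$1$ matrices $t=(t_{i,j})_{i,j\ge 1,\ i+j\le n+1}$, so $\#T_n=2^{n(n+1)/2}$. Let $\pi_n:T_{n+1}\to T_n$ erase the last diagonal, $(\pi_n t)_{i,j}=t_{i,j}$, and let $\sigma_n:T_{n+1}\to T_n$ erase the first column, $(\sigma_n t)_{i,j}=t_{i,j+1}$. Let $\Sigma=\{0,1\}^{\mathbb N^+\times\mathbb N^+}$ with the product topology, let $\sigma:\Sigma\to\Sigma$, $(\sigma s)_{i,j}=s_{i,j+1}$, be the column shift, let $\pi_n s=(s_{i,j})_{i+j\le n+1}\in T_n$ for $s\in\Sigma$, and let $\nu$ be the uniform product measure on $\Sigma$ (a cylinder fixing $k$ entries has measure $2^{-k}$). Let $f:[0,1]\to[0,1]$ be continuous. An atom doubling cascade for $f$ consists, for each $n\ge1$, of pairwise disjoint nondegenerate compact intervals $\overline I_t\subset[0,1]$, $t\in T_n$ (the atoms of generation $n$), such that, with $I_t$ the interior of $\overline I_t$ and all interiors taken in $[0,1]$: - $\max_{t\in T_n}\mathrm{length}(\overline I_t)\to0$ as $n\to\infty$;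 - $\mathrm{int}(f(\overline I_t))\supsetneq \overline I_0\cup\overline I_1$ for $t\in T_1=\{0,1\}$; - $\overline I_t\subset I_{\pi_{n-1}t}$ and $\mathrm{int}(f(I_t))\supsetneq\overline I_{\sigma_{n-1}t}$ for all $n\ge2$, $t\in T_n$; - $\overline I_t\subset f^{-1}(I_{\pi_{n-2}\sigma_{n-1}t})$ for all $n\ge3$, $t\in T_n$. Its $\Lambda$-set is $\Lambda=\bigcap_{n\ge1}\bigcup_{t\in T_n}\overline I_t$. For a transformation $g$ preserving a probability measure $m$ and a finite measurable partition $\mathcal P$, put $h(\mathcal P,g,m)=\lim_{n\to\infty}\frac1n H\big(\bigvee_{j=0}^{n-1}g^{-j}\mathcal P,m\big)$, where $H(\mathcal Q,m)=-\sum_{B\in\mathcal Q}m(B)\log m(B)$, and let the metric entropy be $h_m(g)=\sup_{\mathcal P}h(\mathcal P,g,m)$ over all finite measurable partitions. Theorem. Suppose that $f$ is a continuous map of $[0,1]$ to itself with an atom doubling cascade, and let $\Lambda$ be its $\Lambda$-set. Then there is an $f$-invariant ergodic Borel probability measure $\mu$ on $[0,1]$ with $\mu(\Lambda)=1$ and $h_\mu(f)=+\infty$.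 Moreover $\mu$ can be chosen so that the following hold. 1. There is a homeomorphism $h:\Lambda\to\Sigma$ such that, for $x\in\Lambda$ and $s\in\Sigma$, $h(x)=s$ if and only if $x\in\overline I_{\pi_n s}$ for all $n\ge1$; moreover $f(\Lambda)\subset\Lambda$, $h\circ f|_\Lambda=\sigma\circ h$, and $\mu(A)=\nu(h(A\cap\Lambda))$ for every Borel set $A\subset[0,1]$. 2. The shift $\sigma$ preserves $\nu$ and is strongly mixing: $\nu(\sigma^{-n}A\cap B)\to\nu(A)\nu(B)$ for all Borel sets $A,B\subset\Sigma$. 3. For every $k\ge1$, the partition $\mathcal P_k$ of $\Sigma$ into the sets $\{s:\pi_k s=t\}$, $t\in T_k$, satisfies $h(\mathcal P_k,\sigma,\nu)=k\log2$; likewise the partition of $[0,1]$ into the atoms of generation $k$ and the ($\mu$-null) complement of their union has entropy $k\log 2$ with respect to $f$ and $\mu$. -/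

import Mathlib

open Set Filter Topology MeasureTheory

/-! ### Entropy of a partition and metric entropy -/

/-- A measurable partition of `X` with cells labelled by `ι`. Cells are allowed to be empty;
an empty cell contributes `-0 log 0 = 0` to every entropy below. -/
structure MeasurablePartition (X ι : Type*) [MeasurableSpace X] where
  cell : ι → Set X
  measurableSet_cell : ∀ i, MeasurableSet (cell i)
  disjoint_cell : Pairwise fun i j => Disjoint (cell i) (cell j)
  iUnion_cell : ⋃ i, cell i = univ

namespace MeasurablePartition

variable {X ι : Type*} [MeasurableSpace X]

/-- The cells of `P ∨ f⁻¹ P ∨ ⋯ ∨ f⁻⁽ⁿ⁻¹⁾ P`, labelled by words of length `n`. -/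
def refinedCell (P : MeasurablePartition X ι) (f : X → X) (n : ℕ) (w : Fin n → ι) : Set X :=
  ⋂ j : Fin n, f^[(j : ℕ)] ⁻¹' P.cell (w j)

/-- `H(P ∨ f⁻¹ P ∨ ⋯ ∨ f⁻⁽ⁿ⁻¹⁾ P, μ) = - ∑ μ(B) log μ(B)`, the sum being over the cells `B`. -/
noncomputable def refinedEntropy [Fintype ι] (P : MeasurablePartition X ι) (f : X → X)
    (μ : Measure X) (n : ℕ) : ℝ :=
  -∑ w : Fin n → ι, μ.real (P.refinedCell f n w) * Real.log (μ.real (P.refinedCell f n w))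

/-- The limit of `H(P ∨ ⋯ ∨ f⁻⁽ⁿ⁻¹⁾ P, μ) / n`. For an invariant probability measure
the limit exists by subadditivity; it is written as a lower limit so that the expression makes
sense without an existence proof. -/
noncomputable def entropy [Fintype ι] (P : MeasurablePartition X ι) (f : X → X)
    (μ : Measure X) : EReal :=
  liminf (fun n : ℕ => ((P.refinedEntropy f μ n / n : ℝ) : EReal)) atTop

end MeasurablePartition

/-- The metric (Kolmogorov–Sinai) entropy `h_μ(f)`: the supremum of the entropies of all finite
measurable partitions. -/
noncomputable def metricEntropy {X : Type*} [MeasurableSpace X] (f : X → X) (μ : Measure X) :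
    EReal :=
  ⨆ (m : ℕ) (P : MeasurablePartition X (Fin m)), P.entropy f μ

/-- A measure preserving transformation that is (strongly) mixing. -/
structure StrongMixing {X : Type*} [MeasurableSpace X] (f : X → X) (μ : Measure X) : Prop where
  measurePreserving : MeasurePreserving f μ μ
  tendsto_inter : ∀ A B : Set X, MeasurableSet A → MeasurableSet B →
    Tendsto (fun n : ℕ => μ (f^[n] ⁻¹' A ∩ B)) atTop (𝓝 (μ A * μ B))

/-! ### Triangular and infinite 0-1 matrices

Rows and columns are numbered from `0`: the entry in row `i` and column `j` here is
`t_{i+1,j+1}` in the numbering from `1`. -/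

/-- Positions of a triangular matrix with `n` rows, row `i` having `n - i` entries. -/
abbrev TriIndex (n : ℕ) : Type := {p : ℕ × ℕ // p.1 + p.2 < n}

instance (n : ℕ) : Finite (TriIndex n) :=
  Finite.of_injective
    (fun p : TriIndex n => ((⟨p.1.1, by have := p.2; omega⟩, ⟨p.1.2, by have := p.2; omega⟩) :
      Fin n × Fin n))
    (fun p q h => by
      simp only [Prod.mk.injEq, Fin.mk.injEq] at h
      exact Subtype.ext (Prod.ext h.1 h.2))

noncomputable instance (n : ℕ) : Fintype (TriIndex n) := Fintype.ofFinite _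

/-- The set `T_n` of triangular 0-1 matrices with `n` rows. -/
abbrev TriMatrix (n : ℕ) : Type := TriIndex n → Fin 2

namespace TriMatrix

/-- The projection `π_n : T_{n+1} → T_n` erasing the last diagonal. -/
def proj (n : ℕ) (t : TriMatrix (n + 1)) : TriMatrix n :=
  fun p => t ⟨p.1, by have := p.2; omega⟩

/-- The shift `σ_n : T_{n+1} → T_n` erasing the first column. -/
def shift (n : ℕ) (t : TriMatrix (n + 1)) : TriMatrix n :=
  fun p => t ⟨(p.1.1, p.1.2 + 1), by have := p.2; simp only; omega⟩

end TriMatrix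

/-- The space `{0,1}^{ℕ×ℕ}` of infinite 0-1 matrices, with its product topology and product
(equivalently, Borel) σ-algebra. -/
abbrev BinMatrix : Type := ℕ × ℕ → Fin 2

namespace BinMatrix

/-- The upper left triangle with `n` rows of an infinite matrix. -/
def proj (n : ℕ) (s : BinMatrix) : TriMatrix n := fun p => s p.1

/-- The shift erasing the first column of an infinite matrix. -/
def shift (s : BinMatrix) : BinMatrix := fun p => s (p.1, p.2 + 1)

/-- The uniform product measure: the entries are independent fair bits. -/
noncomputable def uniformMeasure : Measure BinMatrix :=
  Measure.infinitePi fun _ : ℕ × ℕ => (PMF.uniformOfFintype (Fin 2)).toMeasure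

/-- The partition of `{0,1}^{ℕ×ℕ}` into the atoms `{s | π_k s = t}`, `t ∈ T_k`. -/
def atomPartition (k : ℕ) : MeasurablePartition BinMatrix (TriMatrix k) where
  cell t := {s | proj k s = t}
  measurableSet_cell t := by
    have h : Measurable (proj k) := measurable_pi_lambda _ fun p => measurable_pi_apply _
    exact h (measurableSet_singleton t)
  disjoint_cell t t' htt' := by
    exact Set.disjoint_left.2 fun s hs hs' => htt' (hs.symm.trans hs')
  iUnion_cell := by
    ext s
    simp

end BinMatrix

/-! ### Atom doubling cascades

All interiors are taken in the space `[0,1]`. -/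

/-- An atom doubling cascade for a continuous map `f : [0,1] → [0,1]`. The atom of generation
`n ≥ 1` labelled by `t ∈ T_n` is the compact interval `[left n t, right n t]`; the data for
`n = 0` are not used. -/
structure AtomDoublingCascade (f : C(unitInterval, unitInterval)) where
  left : ∀ n : ℕ, TriMatrix n → unitInterval
  right : ∀ n : ℕ, TriMatrix n → unitInterval
  left_lt_right : ∀ n, 1 ≤ n → ∀ t, left n t < right n t
  disjoint_atoms : ∀ n, 1 ≤ n → Pairwise fun t t' : TriMatrix n =>
    Disjoint (Icc (left n t) (right n t)) (Icc (left n t') (right n t'))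
  /-- The maximal length of the atoms of generation `n` tends to `0`. -/
  length_tendsto_zero :
    Tendsto (fun n : ℕ => ⨆ t : TriMatrix n, ((right n t : ℝ) - (left n t : ℝ))) atTop (𝓝 0)
  /-- The two atoms of generation `1` form a 2-horseshoe. -/
  horseshoe : ∀ t : TriMatrix 1,
    (⋃ s : TriMatrix 1, Icc (left 1 s) (right 1 s)) ⊂ interior (f '' Icc (left 1 t) (right 1 t))
  /-- Nesting of the atoms of generation `n + 1 ≥ 2`. -/
  subset_proj : ∀ n, 1 ≤ n → ∀ t : TriMatrix (n + 1),
    Icc (left (n + 1) t) (right (n + 1) t) ⊆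
      interior (Icc (left n (t.proj n)) (right n (t.proj n)))
  /-- Covering by the images of the atoms of generation `n + 1 ≥ 2`. -/
  shift_ssubset : ∀ n, 1 ≤ n → ∀ t : TriMatrix (n + 1),
    Icc (left n (t.shift n)) (right n (t.shift n)) ⊂
      interior (f '' interior (Icc (left (n + 1) t) (right (n + 1) t)))
  /-- Localization of the images of the atoms of generation `n + 2 ≥ 3`. -/
  subset_preimage : ∀ n, 1 ≤ n → ∀ t : TriMatrix (n + 2),
    Icc (left (n + 2) t) (right (n + 2) t) ⊆
      f ⁻¹' interior (Icc (left n ((t.shift (n + 1)).proj n)) (right n ((t.shift (n + 1)).proj n)))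

namespace AtomDoublingCascade

variable {f : C(unitInterval, unitInterval)} (𝒜 : AtomDoublingCascade f)

/-- The atom of generation `n ≥ 1` labelled by `t`. -/
def atom (n : ℕ) (t : TriMatrix n) : Set unitInterval := Icc (𝒜.left n t) (𝒜.right n t)

/-- The `Λ`-set of the cascade: the intersection over `n ≥ 1` of the union of the atoms of
generation `n`. -/
def limitSet : Set unitInterval := ⋂ (n : ℕ) (_ : 1 ≤ n), ⋃ t : TriMatrix n, 𝒜.atom n t

/-- The partition of `[0,1]` into the atoms of generation `k ≥ 1` and the complement of their
union. -/
def atomPartition (k : ℕ) (hk : 1 ≤ k) :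
    MeasurablePartition unitInterval (Option (TriMatrix k)) where
  cell o := o.elim (⋃ t, 𝒜.atom k t)ᶜ (𝒜.atom k)
  measurableSet_cell o := by
    cases o with
    | none => exact (MeasurableSet.iUnion fun t => measurableSet_Icc).compl
    | some t => exact measurableSet_Icc
  disjoint_cell o o' h := by
    cases o with
    | none =>
      cases o' with
      | none => exact absurd rfl h
      | some t' =>
        exact (disjoint_compl_right.mono_left (subset_iUnion (𝒜.atom k) t')).symm
    | some t =>
      cases o' with
      | none => exact disjoint_compl_right.mono_left (subset_iUnion (𝒜.atom k) t)
      | some t' => exact 𝒜.disjoint_atoms k hk fun e => h (congrArg some e)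
  iUnion_cell := by
    rw [iUnion_option]
    exact compl_union_self _

end AtomDoublingCascade

/-! Along an infinite 0-1 matrix the atoms are nested with lengths tending to zero, so each matrix
names one point. Disjointness of atoms makes this coding injective, compactness makes it a
homeomorphism onto the limit set, and localization of images turns `f` there into the column shift
(`semiconj_point`). The measure is the push-forward of the fair-bit measure. The shift is mixing
because `n` shifts carry an event to columns from `n` on, independent of any fixed finite set of
entries (`tendsto_measureReal_inter`). Observing triangles of size `k` for `n` steps reveals `kn +
O(k²)` distinct fair bits, so that partition has entropy `k log 2` (`refinedEntropy_map`); since `k`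
is arbitrary, the metric entropy is infinite. -/

theorem hasSum_measureReal_iUnion {X : Type*} [MeasurableSpace X] {μ : Measure X}
    [IsFiniteMeasure μ] {B : ℕ → Set X} (hd : Pairwise (Function.onFun Disjoint B))
    (hB : ∀ i, MeasurableSet (B i)) : HasSum (fun i => μ.real (B i)) (μ.real (⋃ i, B i)) := by
  have h := measure_iUnion (μ := μ) hd hB
  rw [measureReal_def, h, ENNReal.tsum_toReal_eq fun i => measure_ne_top μ _]
  exact (ENNReal.summable_toReal (h ▸ measure_ne_top μ _)).hasSum

/-! ### Invariance and mixing of the column shift -/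

namespace BinMatrix

instance : IsProbabilityMeasure uniformMeasure := by
  unfold uniformMeasure; infer_instance

theorem shift_iterate_apply (n : ℕ) (s : BinMatrix) (p : ℕ × ℕ) :
    shift^[n] s p = s (p.1, p.2 + n) := by
  induction n generalizing s with
  | zero => rfl
  | succ n ih =>
    rw [Function.iterate_succ_apply, ih]
    simp only [shift]
    congr 2

theorem measurable_shift : Measurable shift := by
  unfold shift; fun_prop

theorem measurePreserving_shift : MeasurePreserving shift uniformMeasure uniformMeasure := by
  refine ⟨measurable_shift, ?_⟩
  have hinj : Function.Injective fun p : ℕ × ℕ => (p.1, p.2 + 1) := by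
    rintro ⟨a, b⟩ ⟨c, d⟩ h
    simpa using h
  exact Measure.map_infinitePi_infinitePi_of_inj
    (P := fun _ : ℕ × ℕ => (PMF.uniformOfFintype (Fin 2)).toMeasure) hinj

/-- Reading off coordinates in `S` is measurable for the σ-algebra generated by them. -/
theorem measurable_reindex {κ : Type*} (S : Set (ℕ × ℕ)) (g : κ → ℕ × ℕ) (hg : ∀ k, g k ∈ S) :
    Measurable[⨆ i ∈ S, MeasurableSpace.comap (fun s : BinMatrix => s i) inferInstance]
      fun (s : BinMatrix) k => s (g k) := by
  refine @measurable_pi_lambda _ _ _ (_) _ _ fun k => ?_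
  exact (comap_measurable _).mono (le_iSup₂_of_le (g k) (hg k) le_rfl) le_rfl

/-- Events depending on disjoint sets of entries are independent. -/
theorem measure_inter_of_disjoint {κ κ' : Type*} {S T : Set (ℕ × ℕ)} (hST : Disjoint S T)
    {g : κ → ℕ × ℕ} (hg : ∀ k, g k ∈ S) {g' : κ' → ℕ × ℕ} (hg' : ∀ k, g' k ∈ T)
    {A : Set (κ → Fin 2)} (hA : MeasurableSet A) {B : Set (κ' → Fin 2)} (hB : MeasurableSet B) :
    uniformMeasure ((fun (s : BinMatrix) k => s (g k)) ⁻¹' A ∩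
        (fun (s : BinMatrix) k => s (g' k)) ⁻¹' B) =
      uniformMeasure ((fun (s : BinMatrix) k => s (g k)) ⁻¹' A) *
        uniformMeasure ((fun (s : BinMatrix) k => s (g' k)) ⁻¹' B) := by
  have hind : ProbabilityTheory.iIndepFun (fun (i : ℕ × ℕ) (s : BinMatrix) => s i)
      uniformMeasure :=
    ProbabilityTheory.iIndepFun_infinitePi (X := fun _ (x : Fin 2) => x) fun _ => measurable_id
  have := ProbabilityTheory.indep_iSup_of_disjoint
    (fun i => (measurable_pi_apply i).comap_le) hind hST
  exact (ProbabilityTheory.Indep_iff _ _ _).1 this _ _ (measurable_reindex S g hg hA)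
    (measurable_reindex T g' hg' hB)

/-- Only `B` runs through the π-λ induction while `A` stays arbitrary: against a cylinder `B`,
independence is exact for large `n` whatever `A` is, so `A` needs no approximation. -/
theorem tendsto_measureReal_inter {A B : Set BinMatrix} (hA : MeasurableSet A)
    (hB : MeasurableSet B) :
    Tendsto (fun n : ℕ => uniformMeasure.real (shift^[n] ⁻¹' A ∩ B)) atTop
      (𝓝 (uniformMeasure.real A * uniformMeasure.real B)) := by
  have hAn (n : ℕ) : MeasurableSet (shift^[n] ⁻¹' A) := (measurable_shift.iterate n) hA
  have hνA (n : ℕ) : uniformMeasure.real (shift^[n] ⁻¹' A) = uniformMeasure.real A :=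
    (measurePreserving_shift.iterate n).measureReal_preimage hA.nullMeasurableSet
  induction B, hB using MeasurableSpace.induction_on_inter
    (generateFrom_measurableCylinders (α := fun _ : ℕ × ℕ => Fin 2)).symm
    isPiSystem_measurableCylinders with
  | empty => simp
  | basic B hB =>
    obtain ⟨D, S, hS, rfl⟩ := (mem_measurableCylinders _).1 hB
    refine tendsto_const_nhds.congr' ?_
    obtain ⟨N, hN⟩ := (D.image Prod.snd).exists_nat_subset_range
    filter_upwards [eventually_ge_atTop N] with n hn
    have hsh : shift^[n] = fun (s : BinMatrix) (p : ℕ × ℕ) => s (p.1, p.2 + n) := by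
      ext s p : 2
      exact shift_iterate_apply n s p
    -- The cylinder lives in columns below `N ≤ n`, whereas `shift^[n]` reads only columns from `n`
    -- on.
    have hdisj : Disjoint {p : ℕ × ℕ | n ≤ p.2} (D : Set (ℕ × ℕ)) := by
      refine Set.disjoint_left.2 fun p hp hpD => ?_
      have := hN (Finset.mem_image_of_mem Prod.snd hpD)
      simp only [Finset.mem_range, mem_ofPred_eq] at this hp
      omega
    have := measure_inter_of_disjoint hdisj (g := fun p : ℕ × ℕ => (p.1, p.2 + n))
      (fun k => by simp) (g' := fun p : D => (p : ℕ × ℕ)) (fun k => k.2) hA hS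
    rw [← hνA n, hsh, measureReal_def, measureReal_def, ← ENNReal.toReal_mul]
    exact congrArg ENNReal.toReal this.symm
  | compl B hB ih =>
    rw [probReal_compl_eq_one_sub hB, mul_sub, mul_one]
    refine (tendsto_const_nhds.sub ih).congr fun n => ?_
    rw [← hνA n, ← measureReal_inter_add_sdiff (s := shift^[n] ⁻¹' A) hB, ← sdiff_eq]
    ring
  | iUnion B hdisj hB ih =>
    have hsum : HasSum (fun i => uniformMeasure.real (B i)) (uniformMeasure.real (⋃ i, B i)) :=
      hasSum_measureReal_iUnion hdisj hB
    rw [← (hsum.mul_left _).tsum_eq]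
    -- The measures of the `B i` form a summable bound uniform in `n`, which allows the limit inside
    -- the sum.
    refine (tendsto_tsum_of_dominated_convergence hsum.summable ih
      (.of_forall fun n i => ?_)).congr fun n => ?_
    · rw [Real.norm_of_nonneg measureReal_nonneg]
      exact measureReal_mono inter_subset_right
    · rw [inter_iUnion]
      exact (hasSum_measureReal_iUnion
        (fun i j hij => (hdisj hij).mono inter_subset_right inter_subset_right)
        fun i => (hAn n).inter (hB i)).tsum_eq

theorem strongMixing_shift : StrongMixing shift uniformMeasure where
  measurePreserving := measurePreserving_shift
  tendsto_inter A B hA hB := by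
    rw [← ENNReal.tendsto_toReal_iff (by finiteness) (by finiteness), ENNReal.toReal_mul]
    exact tendsto_measureReal_inter hA hB

end BinMatrix

/-- Mixing of an invariant set with itself gives `μ A = μ A * μ A`, so `μ A` is 0 or 1. -/
theorem StrongMixing.ergodic {X : Type*} [MeasurableSpace X] {f : X → X} {μ : Measure X}
    [IsProbabilityMeasure μ] (hf : StrongMixing f μ) : Ergodic f μ := by
  refine ⟨hf.measurePreserving, ⟨fun A hA hfA => ?_⟩⟩
  have h := hf.tendsto_inter A A hA hA
  have hn (n : ℕ) : f^[n] ⁻¹' A = A := Function.IsFixedPt.preimage_iterate hfA n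
  simp only [hn, inter_self] at h
  have hmul := tendsto_nhds_unique h tendsto_const_nhds
  rw [eventuallyConst_set']
  by_cases h0 : μ A = 0
  · exact .inl (ae_eq_empty.2 h0)
  · refine .inr ((ae_eq_univ_iff_measure_eq hA.nullMeasurableSet).2 ?_)
    rw [measure_univ]
    exact ((ENNReal.mul_eq_left h0 (measure_ne_top μ A)).1 hmul)

/-! ### Entropy of the triangle partitions -/

namespace BinMatrix

/-- The entries which determine the first `n` iterates of a matrix up to its upper left triangle
with `k` rows. -/
noncomputable def window (k n : ℕ) : Finset (ℕ × ℕ) :=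
  Finset.univ.image fun q : Fin n × TriIndex k => (q.2.1.1, q.2.1.2 + q.1)

/-- The `n` translates of the triangle's first column already fill a `k × n` rectangle. -/
theorem mul_le_card_window (k n : ℕ) : k * n ≤ (window k n).card := by
  suffices h : Finset.range k ×ˢ Finset.range n ⊆ window k n by
    simpa using Finset.card_le_card h
  intro p hp
  simp only [Finset.mem_product, Finset.mem_range] at hp
  exact Finset.mem_image.2 ⟨(⟨p.2, hp.2⟩, ⟨(p.1, 0), by simpa using hp.1⟩), Finset.mem_univ _,
    by simp⟩

theorem card_window_le (k n : ℕ) : (window k n).card ≤ k * (n + k) := by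
  suffices h : window k n ⊆ Finset.range k ×ˢ Finset.range (n + k) by
    simpa using Finset.card_le_card h
  intro p hp
  obtain ⟨⟨j, q⟩, -, rfl⟩ := Finset.mem_image.1 hp
  have := q.2
  have := j.2
  simp only [Finset.mem_product, Finset.mem_range]
  omega

theorem tendsto_card_window_div (k : ℕ) :
    Tendsto (fun n : ℕ => ((window k n).card : ℝ) / n) atTop (𝓝 k) := by
  have hup : Tendsto (fun n : ℕ => (k : ℝ) + k * k / n) atTop (𝓝 k) := by
    simpa using tendsto_const_nhds.add
      (tendsto_const_nhds.div_atTop (tendsto_natCast_atTop_atTop (R := ℝ)))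
  refine tendsto_of_tendsto_of_tendsto_of_le_of_le' tendsto_const_nhds hup ?_ ?_ <;>
    filter_upwards [eventually_gt_atTop 0] with n hn
  · rw [le_div_iff₀ (by positivity)]
    exact_mod_cast mul_le_card_window k n
  · rw [div_le_iff₀ (by positivity)]
    have : ((window k n).card : ℝ) ≤ k * (n + k) := by exact_mod_cast card_window_le k n
    refine this.trans_eq ?_
    field_simp

theorem uniformMeasure_real_restrict (D : Finset (ℕ × ℕ)) (u : D → Fin 2) :
    uniformMeasure.real {s | D.restrict s = u} = (2 ^ D.card)⁻¹ := by
  have h : {s : BinMatrix | D.restrict s = u} =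
      cylinder D ({u} : Set (D → Fin 2)) := rfl
  rw [measureReal_def, h, uniformMeasure, Measure.infinitePi_cylinder _ (measurableSet_singleton u),
    Measure.pi_singleton]
  simp

/-- The nonempty fibres correspond to the `2 ^ D.card` equally likely words on `D`. Labels outside
the range of `F`, such as sequences of incompatible triangles, contribute nothing. -/
theorem sum_measure_fiber_mul_log {W : Type*} [Fintype W] (D : Finset (ℕ × ℕ))
    {F : (D → Fin 2) → W} (hF : Function.Injective F) :
    ∑ w, uniformMeasure.real {s : BinMatrix | F (D.restrict s) = w} *
        Real.log (uniformMeasure.real {s : BinMatrix | F (D.restrict s) = w}) =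
      -(D.card * Real.log 2) := by
  classical
  rw [← Finset.sum_subset (Finset.subset_univ (Finset.univ.image F)), Finset.sum_image hF.injOn]
  · simp only [hF.eq_iff, uniformMeasure_real_restrict]
    simp
  · intro w _ hw
    have : {s : BinMatrix | F (D.restrict s) = w} = ∅ := by
      ext s
      simp only [mem_ofPred_eq, mem_empty_iff_false, iff_false]
      rintro rfl
      exact hw (Finset.mem_image_of_mem F (Finset.mem_univ _))
    simp [this]

/-- The entropy of a partition whose pullback to the shift is the partition into triangles. -/
theorem refinedEntropy_map {X ι : Type*} [MeasurableSpace X] [Fintype ι] {f : X → X}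
    (P : MeasurablePartition X ι) {φ : BinMatrix → X} (hφ : Measurable φ)
    (hf : Measurable f) (hsemi : Function.Semiconj φ shift f) {k : ℕ} {c : TriMatrix k → ι}
    (hc : Function.Injective c) (hP : ∀ s, φ s ∈ P.cell (c (s.proj k))) (n : ℕ) :
    P.refinedEntropy f (uniformMeasure.map φ) n = (window k n).card * Real.log 2 := by
  have hcell (s : BinMatrix) (i : ι) : φ s ∈ P.cell i ↔ c (s.proj k) = i := by
    refine ⟨fun h => ?_, fun h => h ▸ hP s⟩
    by_contra hne
    exact Set.disjoint_left.1 (P.disjoint_cell hne) (hP s) h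
  have hmem (q : Fin n × TriIndex k) : (q.2.1.1, q.2.1.2 + (q.1 : ℕ)) ∈ window k n :=
    Finset.mem_image_of_mem _ (Finset.mem_univ q)
  -- `F` turns the window's entries into the itinerary of `n` overlapping triangles; it is injective
  -- because every window entry occurs in one of them.
  let F : (window k n → Fin 2) → Fin n → ι :=
    fun u j => c fun p => u ⟨(p.1.1, p.1.2 + j), hmem (j, p)⟩
  have hF : Function.Injective F := by
    intro u v huv
    ext ⟨p, hp⟩ : 1
    obtain ⟨⟨j, q⟩, -, rfl⟩ := Finset.mem_image.1 hp
    exact congrFun (hc (congrFun huv j)) q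
  have hpre (w : Fin n → ι) : (uniformMeasure.map φ).real (P.refinedCell f n w) =
      uniformMeasure.real {s : BinMatrix | F ((window k n).restrict s) = w} := by
    rw [MeasurablePartition.refinedCell, map_measureReal_apply hφ
      (MeasurableSet.iInter fun j : Fin n => (hf.iterate j) (P.measurableSet_cell (w j)))]
    congr 1
    ext s
    simp only [mem_preimage, mem_iInter, mem_ofPred_eq,
      funext_iff (g := w)]
    refine forall_congr' fun j => ?_
    rw [← (hsemi.iterate_right j).eq, hcell]
    have : proj k (shift^[j] s) = fun p => s (p.1.1, p.1.2 + j) :=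
      funext fun p => shift_iterate_apply j s p.1
    rw [this]
    rfl
  simp only [MeasurablePartition.refinedEntropy, hpre]
  rw [sum_measure_fiber_mul_log _ hF, neg_neg]

/-- General `φ` and `c` serve the shift itself, the atoms with their complement, and the latter
relabelled by `Fin m`. -/
theorem tendsto_refinedEntropy_map {X ι : Type*} [MeasurableSpace X] [Fintype ι] {f : X → X}
    (P : MeasurablePartition X ι) {φ : BinMatrix → X} (hφ : Measurable φ)
    (hf : Measurable f) (hsemi : Function.Semiconj φ shift f) {k : ℕ} {c : TriMatrix k → ι}
    (hc : Function.Injective c) (hP : ∀ s, φ s ∈ P.cell (c (s.proj k))) :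
    Tendsto (fun n : ℕ => P.refinedEntropy f (uniformMeasure.map φ) n / n) atTop
      (𝓝 (k * Real.log 2)) := by
  refine ((tendsto_card_window_div k).mul_const (Real.log 2)).congr fun n => ?_
  rw [refinedEntropy_map P hφ hf hsemi hc hP, div_mul_eq_mul_div]

end BinMatrix

namespace MeasurablePartition

variable {X ι κ : Type*} [MeasurableSpace X]

/-- Relabelling the cells of a partition. -/
def reindex (P : MeasurablePartition X ι) (e : κ ≃ ι) : MeasurablePartition X κ where
  cell i := P.cell (e i)
  measurableSet_cell i := P.measurableSet_cell (e i)
  disjoint_cell _ _ h := P.disjoint_cell (e.injective.ne h)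
  iUnion_cell := (e.surjective.iUnion_comp P.cell).trans P.iUnion_cell

theorem entropy_eq_of_tendsto [Fintype ι] {P : MeasurablePartition X ι} {f : X → X}
    {μ : Measure X} {a : ℝ} (h : Tendsto (fun n : ℕ => P.refinedEntropy f μ n / n) atTop (𝓝 a)) :
    P.entropy f μ = a :=
  ((continuous_coe_real_ereal.tendsto a).comp h).liminf_eq

end MeasurablePartition

/-! ### Coding of the limit set -/

namespace BinMatrix

/-- A compatible sequence of triangular matrices consists of the triangles of a matrix. -/
theorem exists_forall_proj_eq {t : ∀ n, TriMatrix n}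
    (ht : ∀ n, 1 ≤ n → (t (n + 1)).proj n = t n) :
    ∃ s : BinMatrix, ∀ n, 1 ≤ n → s.proj n = t n := by
  -- Entry `p` is read from the smallest triangle containing it; compatibility propagates it to all
  -- larger ones.
  have h (p : ℕ × ℕ) (n : ℕ) (hn : p.1 + p.2 + 1 ≤ n) :
      t (p.1 + p.2 + 1) ⟨p, by omega⟩ = t n ⟨p, hn⟩ := by
    induction n, hn using Nat.le_induction with
    | base => rfl
    | succ n hn ih => exact ih.trans (congrFun (ht n (by omega)) ⟨p, hn⟩).symm
  exact ⟨fun p => t (p.1 + p.2 + 1) ⟨p, by omega⟩, fun n _ => funext fun p => h p.1 n p.2⟩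

theorem eq_of_forall_proj_eq {s s' : BinMatrix} (h : ∀ n, 1 ≤ n → s.proj n = s'.proj n) :
    s = s' :=
  funext fun p => congrFun (h (p.1 + p.2 + 1) (by omega)) ⟨p, by omega⟩

theorem isOpen_setOf_proj_eq (n : ℕ) (t : TriMatrix n) : IsOpen {s : BinMatrix | s.proj n = t} :=
  (isOpen_discrete {t}).preimage (f := proj n) (continuous_pi fun _ => continuous_apply _)

end BinMatrix

namespace AtomDoublingCascade

variable {f : C(unitInterval, unitInterval)} (𝒜 : AtomDoublingCascade f)

theorem eq_of_mem_atom {n : ℕ} (hn : 1 ≤ n) {t t' : TriMatrix n} {x : unitInterval}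
    (ht : x ∈ 𝒜.atom n t) (ht' : x ∈ 𝒜.atom n t') : t = t' := by
  by_contra h
  exact Set.disjoint_left.1 (𝒜.disjoint_atoms n hn h) ht ht'

theorem atom_subset_atom_proj {n : ℕ} (hn : 1 ≤ n) (t : TriMatrix (n + 1)) :
    𝒜.atom (n + 1) t ⊆ 𝒜.atom n (t.proj n) :=
  (𝒜.subset_proj n hn t).trans interior_subset

/-- The maximal length of the atoms of generation `n`. -/
noncomputable def mesh (n : ℕ) : ℝ :=
  ⨆ t : TriMatrix n, ((𝒜.right n t : ℝ) - (𝒜.left n t : ℝ))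

theorem dist_le_mesh {n : ℕ} {t : TriMatrix n} {x y : unitInterval} (hx : x ∈ 𝒜.atom n t)
    (hy : y ∈ 𝒜.atom n t) : dist x y ≤ 𝒜.mesh n :=
  (Real.dist_le_of_mem_Icc (x := (x : ℝ)) (y := y) hx hy).trans
    (le_ciSup (f := fun t : TriMatrix n => ((𝒜.right n t : ℝ) - (𝒜.left n t : ℝ)))
      (Set.finite_range _).bddAbove t)

theorem exists_forall_mem_atom (s : BinMatrix) :
    ∃ x, ∀ n, 1 ≤ n → x ∈ 𝒜.atom n (s.proj n) := by
  obtain ⟨x, hx⟩ := IsCompact.nonempty_iInter_of_sequence_nonempty_isCompact_isClosed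
    (fun n => 𝒜.atom (n + 1) (s.proj (n + 1)))
    (fun n => 𝒜.atom_subset_atom_proj (by omega) (s.proj (n + 2)))
    (fun n => nonempty_Icc.2 (𝒜.left_lt_right (n + 1) (by omega) _).le)
    isCompact_Icc (fun n => isClosed_Icc)
  refine ⟨x, fun n hn => ?_⟩
  obtain ⟨m, rfl⟩ := Nat.exists_eq_add_of_le' hn
  exact mem_iInter.1 hx m

/-- The point of the limit set with a given itinerary. -/
noncomputable def point (s : BinMatrix) : unitInterval := (𝒜.exists_forall_mem_atom s).choose

theorem point_mem_atom (s : BinMatrix) {n : ℕ} (hn : 1 ≤ n) : 𝒜.point s ∈ 𝒜.atom n (s.proj n) :=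
  (𝒜.exists_forall_mem_atom s).choose_spec n hn

theorem eq_point {s : BinMatrix} {x : unitInterval}
    (hx : ∀ n, 1 ≤ n → x ∈ 𝒜.atom n (s.proj n)) : x = 𝒜.point s := by
  refine dist_le_zero.1 (ge_of_tendsto 𝒜.length_tendsto_zero ?_)
  filter_upwards [eventually_ge_atTop 1] with n hn
  exact 𝒜.dist_le_mesh (hx n hn) (𝒜.point_mem_atom s hn)

theorem point_mem_limitSet (s : BinMatrix) : 𝒜.point s ∈ 𝒜.limitSet :=
  mem_iInter₂.2 fun _ hn => mem_iUnion.2 ⟨_, 𝒜.point_mem_atom s hn⟩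

theorem injective_point : Function.Injective 𝒜.point := fun s s' h =>
  BinMatrix.eq_of_forall_proj_eq fun _ hn =>
    𝒜.eq_of_mem_atom hn (𝒜.point_mem_atom s hn) (h ▸ 𝒜.point_mem_atom s' hn)

theorem exists_point_eq {x : unitInterval} (hx : x ∈ 𝒜.limitSet) : ∃ s, 𝒜.point s = x := by
  have h (n : ℕ) : ∃ t, 1 ≤ n → x ∈ 𝒜.atom n t := by
    by_cases hn : 1 ≤ n
    · obtain ⟨t, ht⟩ := mem_iUnion.1 (mem_iInter₂.1 hx n hn)
      exact ⟨t, fun _ => ht⟩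
    -- Generation 0 is unconstrained, so any label will do.
    · exact ⟨0, fun h => absurd h hn⟩
  choose t ht using h
  obtain ⟨s, hs⟩ := BinMatrix.exists_forall_proj_eq (t := t) fun n hn =>
    𝒜.eq_of_mem_atom hn (𝒜.atom_subset_atom_proj hn _ (ht (n + 1) (by omega))) (ht n hn)
  exact ⟨s, (𝒜.eq_point fun n hn => (hs n hn).symm ▸ ht n hn).symm⟩

/-- Matrices with the same `n`-row triangle have their points in one atom of generation `n`, so
within `mesh n`. -/
theorem continuous_point : Continuous 𝒜.point := by
  refine continuous_iff_continuousAt.2 fun s => Metric.tendsto_nhds.2 fun ε hε => ?_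
  obtain ⟨n, hn, hn1⟩ := ((𝒜.length_tendsto_zero.eventually_lt_const hε).and
    (eventually_ge_atTop 1)).exists
  filter_upwards [(BinMatrix.isOpen_setOf_proj_eq n (s.proj n)).mem_nhds rfl] with s' hs'
  have hs' : s'.proj n = s.proj n := hs'
  exact (𝒜.dist_le_mesh (hs' ▸ 𝒜.point_mem_atom s' hn1) (𝒜.point_mem_atom s hn1)).trans_lt hn

/-- The image of `point s` lies in every atom of the shifted matrix. Two generations are spent each
time: one diagonal is lost to the shift, one to the projection. -/
theorem semiconj_point : Function.Semiconj 𝒜.point BinMatrix.shift f := fun s =>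
  (𝒜.eq_point fun n hn => interior_subset
    (𝒜.subset_preimage n hn (s.proj (n + 2)) (𝒜.point_mem_atom s (by omega)))).symm

/-- The homeomorphism of the space of binary matrices onto the limit set. -/
noncomputable def pointHomeomorph : BinMatrix ≃ₜ 𝒜.limitSet :=
  -- A continuous bijection from a compact space to a Hausdorff one is a homeomorphism.
  Continuous.homeoOfEquivCompactToT2
    (f := Equiv.ofBijective (fun s => (⟨𝒜.point s, 𝒜.point_mem_limitSet s⟩ : 𝒜.limitSet))
      ⟨fun _ _ h => 𝒜.injective_point (congrArg Subtype.val h), fun x =>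
        (𝒜.exists_point_eq x.2).imp fun _ h => Subtype.ext h⟩)
    (𝒜.continuous_point.subtype_mk _)

theorem coe_pointHomeomorph (s : BinMatrix) : (𝒜.pointHomeomorph s : unitInterval) = 𝒜.point s :=
  rfl

theorem point_pointHomeomorph_symm (x : 𝒜.limitSet) :
    𝒜.point (𝒜.pointHomeomorph.symm x) = x := by
  rw [← coe_pointHomeomorph, Homeomorph.apply_symm_apply]

/-- The image of the uniform measure on binary matrices, carried by the limit set. -/
noncomputable def limitMeasure : Measure unitInterval := BinMatrix.uniformMeasure.map 𝒜.point

instance : IsProbabilityMeasure 𝒜.limitMeasure :=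
  Measure.isProbabilityMeasure_map 𝒜.continuous_point.measurable.aemeasurable

theorem tendsto_refinedEntropy_atomPartition (k : ℕ) (hk : 1 ≤ k) :
    Tendsto (fun n : ℕ => (𝒜.atomPartition k hk).refinedEntropy f 𝒜.limitMeasure n / n)
      atTop (𝓝 (k * Real.log 2)) :=
  BinMatrix.tendsto_refinedEntropy_map _ 𝒜.continuous_point.measurable f.continuous.measurable
    𝒜.semiconj_point (Option.some_injective _) fun s => 𝒜.point_mem_atom s hk

theorem metricEntropy_limitMeasure : metricEntropy f 𝒜.limitMeasure = ⊤ := by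
  have h (k : ℕ) (hk : 1 ≤ k) :
      ((k * Real.log 2 : ℝ) : EReal) ≤ metricEntropy f 𝒜.limitMeasure := by
    -- The supremum defining `metricEntropy` runs over partitions labelled by `Fin m`.
    let e := Fintype.equivFin (Option (TriMatrix k))
    let P := (𝒜.atomPartition k hk).reindex e.symm
    have hP : P.entropy f 𝒜.limitMeasure = ((k * Real.log 2 : ℝ) : EReal) :=
      MeasurablePartition.entropy_eq_of_tendsto <| BinMatrix.tendsto_refinedEntropy_map P
        𝒜.continuous_point.measurable f.continuous.measurable 𝒜.semiconj_point
        (e.injective.comp (Option.some_injective _)) fun s => by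
          simp only [P, MeasurablePartition.reindex, Function.comp_apply, Equiv.symm_apply_apply]
          exact 𝒜.point_mem_atom s hk
    rw [← hP]
    exact le_iSup₂_of_le (Fintype.card (Option (TriMatrix k))) P le_rfl
  refine EReal.eq_top_iff_forall_lt _ |>.2 fun y => ?_
  obtain ⟨k, hk⟩ := exists_nat_gt (y / Real.log 2)
  refine lt_of_lt_of_le ?_ (h (k + 1) (by omega))
  rw [div_lt_iff₀ (Real.log_pos one_lt_two)] at hk
  have := Real.log_pos one_lt_two
  rw [EReal.coe_lt_coe_iff]
  push_cast
  linarith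

end AtomDoublingCascade

theorem mainTheorem7 (f : C(unitInterval, unitInterval)) (𝒜 : AtomDoublingCascade f) :
    ∃ μ : Measure unitInterval,
      IsProbabilityMeasure μ ∧
      Ergodic f μ ∧
      μ 𝒜.limitSetᶜ = 0 ∧
      metricEntropy f μ = ⊤ ∧
      (∃ h : 𝒜.limitSet ≃ₜ BinMatrix,
        (∀ (x : 𝒜.limitSet) (s : BinMatrix),
          h x = s ↔ ∀ n, 1 ≤ n → (x : unitInterval) ∈ 𝒜.atom n (s.proj n)) ∧
        (∀ x : 𝒜.limitSet, ∃ hfx : f x ∈ 𝒜.limitSet, h ⟨f x, hfx⟩ = (h x).shift) ∧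
        (∀ A : Set unitInterval, MeasurableSet A →
          μ A = BinMatrix.uniformMeasure (h '' {x : 𝒜.limitSet | (x : unitInterval) ∈ A}))) ∧
      StrongMixing BinMatrix.shift BinMatrix.uniformMeasure ∧
      (∀ k, 1 ≤ k →
        Tendsto
          (fun n : ℕ => (BinMatrix.atomPartition k).refinedEntropy BinMatrix.shift
            BinMatrix.uniformMeasure n / n)
          atTop (𝓝 (k * Real.log 2))) ∧
      (∀ (k : ℕ) (hk : 1 ≤ k),
        Tendsto (fun n : ℕ => (𝒜.atomPartition k hk).refinedEntropy f μ n / n)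
          atTop (𝓝 (k * Real.log 2))) := by
  have hmeas := 𝒜.continuous_point.measurable
  refine ⟨𝒜.limitMeasure, inferInstance, ?_, ?_, 𝒜.metricEntropy_limitMeasure,
    ⟨𝒜.pointHomeomorph.symm, ?_, ?_, ?_⟩, BinMatrix.strongMixing_shift, ?_,
    𝒜.tendsto_refinedEntropy_atomPartition⟩
  -- Ergodicity passes to factors.
  · exact (hmeas.measurePreserving _).ergodic_of_ergodic_semiconj
      BinMatrix.strongMixing_shift.ergodic f.continuous.measurable 𝒜.semiconj_point
  · have hΛ : MeasurableSet 𝒜.limitSet :=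
      .iInter fun _ => .iInter fun _ => .iUnion fun _ => measurableSet_Icc
    rw [AtomDoublingCascade.limitMeasure, Measure.map_apply hmeas hΛ.compl]
    convert! measure_empty (μ := BinMatrix.uniformMeasure)
    exact eq_empty_of_forall_notMem fun s hs => hs (𝒜.point_mem_limitSet s)
  · intro x s
    constructor
    · rintro rfl n hn
      simpa only [𝒜.point_pointHomeomorph_symm] using
        𝒜.point_mem_atom (𝒜.pointHomeomorph.symm x) hn
    · exact fun h => (Homeomorph.symm_apply_eq _).2 (Subtype.ext (𝒜.eq_point h))
  · intro x
    have hx := 𝒜.point_pointHomeomorph_symm x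
    have hfx : f x = 𝒜.point (𝒜.pointHomeomorph.symm x).shift := by
      rw [𝒜.semiconj_point.eq, hx]
    refine ⟨hfx ▸ 𝒜.point_mem_limitSet _, ?_⟩
    exact (Homeomorph.symm_apply_eq _).2 (Subtype.ext hfx)
  · intro A hA
    rw [AtomDoublingCascade.limitMeasure, Measure.map_apply hmeas hA, Homeomorph.image_symm]
    rfl
  · intro k _
    simpa using BinMatrix.tendsto_refinedEntropy_map (BinMatrix.atomPartition k)
      measurable_id BinMatrix.measurable_shift Function.Semiconj.id_left
      Function.injective_id fun s => rfl
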